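/- Let $\kappa<0$ and let $(X,\rho)$ be a complete CAT($\kappa$) space, i.e. a complete metric space in which every two points are joined by a metric segment (the image of a geodesic, that is, an isometric embedding of a compact interval) and in which all geodesic triangles satisfy the CAT($\kappa$) inequality: for every geodesic triangle $\triangle$ in $X$, every comparison triangle $\bar\triangle$ with the same edge lengths in the model plane $M^2_\kappa$ (the hyperbolic plane $\mathbb{H}^2$ with its distance multiplied by $1/\sqrt{-\kappa}$), and all $a,b\in\triangle$ with comparison points $\bar a,\bar b\in\bar\triangle$, one has $\rho(a,b)\le d(\bar a,\bar b)$. Let $K\subseteq X$ be nonempty, closed and convex (i.e. $K$ contains every metric segment joining two of its points). Then the following are equivalent: (i) $K$ has the fixed point property for nonexpansive mappings, i.e. every map $T\colon K\to K$ with $\rho(Tx,Ty)\le\rho(x,y)$ for all $x,y\in K$ has a fixed point; (ii) $K$ is geodesically bounded, i.e. there is no infinite geodesic in $K$: no map $c\colon[0,\infty)\to K$ satisfies $\rho(c(s),c(t))=|s-t|$ for all $s,t\ge 0$. -/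

import Mathlib

/-! ### Geodesics in a space with a distance function -/

/-- `c` restricted to `I` is a geodesic parametrized by arc length. -/
def IsGeodesicOn {X : Type*} [Dist X] (c : ℝ → X) (I : Set ℝ) : Prop :=
  ∀ s ∈ I, ∀ t ∈ I, dist (c s) (c t) = |s - t|

/-- `S` is a metric segment joining `x` to `y`: the image of a geodesic from `x` to `y`. -/
def IsMetricSegment {X : Type*} [Dist X] (x y : X) (S : Set X) : Prop :=
  ∃ c : ℝ → X, c 0 = x ∧ c (dist x y) = y ∧ IsGeodesicOn c (Set.Icc 0 (dist x y)) ∧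
    S = c '' Set.Icc 0 (dist x y)

/-- Every two points are joined by a metric segment. -/
def IsGeodesicSpace (X : Type*) [Dist X] : Prop :=
  ∀ x y : X, ∃ S : Set X, IsMetricSegment x y S

/-- A set is convex if it contains the metric segments joining its points. -/
def IsGeodesicallyConvex {X : Type*} [Dist X] (K : Set X) : Prop :=
  ∀ x ∈ K, ∀ y ∈ K, ∀ S : Set X, IsMetricSegment x y S → S ⊆ K

/-- A set is geodesically bounded if it contains no infinite geodesic `c : [0, ∞) → K`. -/
def IsGeodesicallyBounded {X : Type*} [Dist X] (K : Set X) : Prop :=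
  ¬ ∃ c : ℝ → X, IsGeodesicOn c (Set.Ici 0) ∧ ∀ t ∈ Set.Ici (0 : ℝ), c t ∈ K

/-- Every nonexpansive mapping `T : K → K` has a fixed point. -/
def HasNonexpansiveFPP {X : Type*} [MetricSpace X] (K : Set X) : Prop :=
  ∀ T : K → K, (∀ x y : K, dist (T x) (T y) ≤ dist x y) → ∃ x : K, T x = x

/-- A geodesic triangle: three vertices with a choice of metric segments as its edges. -/
structure GeodesicTriangle (X : Type*) [Dist X] where
  x : X
  y : X
  z : X
  xy : Set X
  yz : Set X
  zx : Set X
  isSegment_xy : IsMetricSegment x y xy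
  isSegment_yz : IsMetricSegment y z yz
  isSegment_zx : IsMetricSegment z x zx

/-! ### The model planes of negative curvature -/

/-- The symmetric bilinear form `u₁v₁ + u₂v₂ - u₃v₃` on `ℝ³`. -/
def lorentzForm (u v : Fin 3 → ℝ) : ℝ :=
  u 0 * v 0 + u 1 * v 1 - u 2 * v 2

/-- The underlying set of the model plane of curvature `κ < 0`: the upper sheet of the
hyperboloid. The parameter `κ` enters only the distance function below. -/
structure ModelPlane (κ : ℝ) where
  vec : Fin 3 → ℝ
  form_self : lorentzForm vec vec = -1
  one_le : 1 ≤ vec 2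

/-- The hyperbolic distance `arcosh (-⟨u|v⟩)`, multiplied by `1 / √(-κ)`; meant for `κ < 0`. -/
noncomputable instance ModelPlane.instDist (κ : ℝ) : Dist (ModelPlane κ) where
  dist u v := 1 / √(-κ) * Real.arcosh (-lorentzForm u.vec v.vec)

/-! ### CAT(κ) spaces -/

/-- `Δ'` has the same edge lengths as `Δ`. -/
def IsComparisonTriangle {X : Type*} [Dist X] {κ : ℝ}
    (Δ : GeodesicTriangle X) (Δ' : GeodesicTriangle (ModelPlane κ)) : Prop :=
  dist Δ'.x Δ'.y = dist Δ.x Δ.y ∧ dist Δ'.y Δ'.z = dist Δ.y Δ.z ∧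
    dist Δ'.z Δ'.x = dist Δ.z Δ.x

/-- `a'` is a comparison point of `a`: it lies on the corresponding edge, at the same distance
from the initial vertex of that edge. -/
def IsComparisonPoint {X : Type*} [Dist X] {κ : ℝ}
    (Δ : GeodesicTriangle X) (Δ' : GeodesicTriangle (ModelPlane κ))
    (a : X) (a' : ModelPlane κ) : Prop :=
  (a ∈ Δ.xy ∧ a' ∈ Δ'.xy ∧ dist Δ'.x a' = dist Δ.x a) ∨
  (a ∈ Δ.yz ∧ a' ∈ Δ'.yz ∧ dist Δ'.y a' = dist Δ.y a) ∨
  (a ∈ Δ.zx ∧ a' ∈ Δ'.zx ∧ dist Δ'.z a' = dist Δ.z a)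

/-- `X` is a CAT(κ) space, for `κ < 0`: a geodesic space all of whose geodesic triangles satisfy
the CAT(κ) inequality with respect to their comparison triangles in the model plane. -/
def IsCAT (κ : ℝ) (X : Type*) [MetricSpace X] : Prop :=
  IsGeodesicSpace X ∧
  ∀ (Δ : GeodesicTriangle X) (Δ' : GeodesicTriangle (ModelPlane κ)), IsComparisonTriangle Δ Δ' →
    ∀ (a b : X) (a' b' : ModelPlane κ), IsComparisonPoint Δ Δ' a a' →
      IsComparisonPoint Δ Δ' b b' → dist a b ≤ dist a' b'

/-! ### Hyperbolic trigonometry -/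

/-! If `K` contains a ray `c`, its Busemann function `b` (with sign chosen so that `b (c s) = s`) is
1-Lipschitz, and `x ↦ c (max (b x) 0 + 1)` is nonexpansive without fixed points.

Conversely, let `T` have no fixed point and fix `p ∈ K`. Composing `T` with the contraction towards
`p` by a factor `r n < 1` gives a strict contraction (`IsCAT.dist_mul_le`), hence points `x n` on
`[p, T (x n)]` at distance `a n = r n * dist p (T (x n))` from `p`; let `r n → 1`. For two such
points, prolonging the sides from `x m`, `x n` to their images does not lengthen the third side. In
the hyperbolic plane this forces a non-acute angle at the point nearer to `p`
(`sinh_mul_cosh_le_of_lengthen`), and `IsCAT.cosh_dist_le_of_dist_le` draws two conclusions. If `a n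
→ ∞`, the angles at `p` tend to 0 and the segments `[p, T (x n)]` converge to a ray in `K`.
Otherwise `a` converges along a subsequence, Pythagoras makes `x` Cauchy there, and the limit is a
fixed point. Curvature enters only through the hinge comparison `IsCAT.exists_comparison_cos`. -/

theorem sinh_sub_combination (D s t : ℝ) :
    Real.sinh (D - s) * Real.sinh (D - t) + Real.sinh s * Real.sinh t +
      Real.cosh D * (Real.sinh (D - s) * Real.sinh t + Real.sinh s * Real.sinh (D - t)) =
      Real.sinh D ^ 2 * Real.cosh (s - t) := by
  rw [Real.sinh_sub, Real.sinh_sub, Real.cosh_sub]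
  linear_combination (-(Real.sinh s * Real.sinh t)) * Real.cosh_sq D

/-- This is the case `t = 0` of `sinh_sub_combination` with a factor `sinh D` cancelled. -/
theorem sinh_sub_add_sinh_mul_cosh (D s : ℝ) :
    Real.sinh (D - s) + Real.sinh s * Real.cosh D = Real.sinh D * Real.cosh s := by
  rw [Real.sinh_sub]; ring

/-- The quotient `sinh (r x) / sinh x` is decreasing for `x > 0`. -/
theorem sinh_mul_ratio_antitone {r : ℝ} (hr0 : 0 ≤ r) (hr1 : r ≤ 1) {x y : ℝ} (hx : 0 ≤ x)
    (hxy : x ≤ y) :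
    Real.sinh (r * y) * Real.sinh x ≤ Real.sinh (r * x) * Real.sinh y := by
  -- The difference of the two sides is the numerator of the derivative of `sinh (r z) / sinh z`. It
  -- vanishes at 0 and has derivative `(r² - 1) sinh (r z) sinh z ≤ 0`.
  have hnum : ∀ z : ℝ, 0 ≤ z →
      r * Real.cosh (r * z) * Real.sinh z ≤ Real.sinh (r * z) * Real.cosh z := by
    intro z hz
    have hanti : AntitoneOn (fun z : ℝ => r * Real.cosh (r * z) * Real.sinh z -
        Real.sinh (r * z) * Real.cosh z) (Set.Ici 0) := by
      have hd : ∀ w : ℝ, HasDerivAt (fun z : ℝ => r * Real.cosh (r * z) * Real.sinh z -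
        Real.sinh (r * z) * Real.cosh z) ((r ^ 2 - 1) * (Real.sinh (r * w) * Real.sinh w)) w := by
        intro w
        have h1 : HasDerivAt (fun z : ℝ => r * z) r w := by
          simpa using (hasDerivAt_id w).const_mul r
        refine HasDerivAt.congr_deriv ((((h1.cosh).const_mul r).mul (Real.hasDerivAt_sinh w)).sub
          ((h1.sinh).mul (Real.hasDerivAt_cosh w))) ?_
        ring
      refine antitoneOn_of_deriv_nonpos (convex_Ici 0)
        (fun w _ => (hd w).continuousAt.continuousWithinAt)
        (fun w _ => (hd w).differentiableAt.differentiableWithinAt) ?_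
      intro w hw
      rw [interior_Ici] at hw
      rw [(hd w).deriv]
      have hw' : 0 ≤ w := le_of_lt hw
      have h2 : 0 ≤ Real.sinh (r * w) * Real.sinh w :=
        mul_nonneg (Real.sinh_nonneg_iff.2 (mul_nonneg hr0 hw')) (Real.sinh_nonneg_iff.2 hw')
      exact mul_nonpos_of_nonpos_of_nonneg (by nlinarith) h2
    have := hanti (Set.mem_Ici.2 le_rfl) (Set.mem_Ici.2 hz) hz
    simp only [mul_zero, Real.sinh_zero, zero_mul, sub_zero] at this
    linarith
  rcases hx.eq_or_lt with rfl | hx0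
  · simp
  have hanti : AntitoneOn (fun z : ℝ => Real.sinh (r * z) / Real.sinh z) (Set.Ici x) := by
    have hd : ∀ w : ℝ, 0 < w → HasDerivAt (fun z : ℝ => Real.sinh (r * z) / Real.sinh z)
        ((r * Real.cosh (r * w) * Real.sinh w - Real.sinh (r * w) * Real.cosh w) /
          Real.sinh w ^ 2) w := by
      intro w hw
      have h1 : HasDerivAt (fun z : ℝ => r * z) r w := by
        simpa using (hasDerivAt_id w).const_mul r
      refine HasDerivAt.congr_deriv ((h1.sinh).div (Real.hasDerivAt_sinh w) (Real.sinh_pos_iff.2 hw).ne') ?_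
      ring
    refine antitoneOn_of_deriv_nonpos (convex_Ici x)
      (fun w hw => (hd w (hx0.trans_le hw)).continuousAt.continuousWithinAt) ?_ ?_
    · intro w hw
      exact (hd w (hx0.trans_le (interior_subset hw))).differentiableAt.differentiableWithinAt
    · intro w hw
      have hw0 : 0 < w := hx0.trans_le (interior_subset hw)
      rw [(hd w hw0).deriv]
      exact div_nonpos_of_nonpos_of_nonneg (sub_nonpos.2 (hnum w hw0.le)) (sq_nonneg _)
  have h := hanti (Set.mem_Ici.2 le_rfl) (Set.mem_Ici.2 hxy) hxy
  simp only at h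
  rwa [div_le_div_iff₀ (Real.sinh_pos_iff.2 (hx0.trans_le hxy)) (Real.sinh_pos_iff.2 hx0)] at h

/-- Convexity of `sinh` on `[0, ∞)` together with `sinh 0 = 0`. It serves the tangent at `D = 0`,
where division by `sinh D` fails. -/
theorem sinh_mul_le {r : ℝ} (hr0 : 0 ≤ r) (hr1 : r ≤ 1) {x : ℝ} (hx : 0 ≤ x) :
    Real.sinh (r * x) ≤ r * Real.sinh x := by
  have hmono : MonotoneOn (fun z : ℝ => r * Real.sinh z - Real.sinh (r * z)) (Set.Ici 0) := by
    have hd : ∀ w : ℝ, HasDerivAt (fun z : ℝ => r * Real.sinh z - Real.sinh (r * z))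
        (r * (Real.cosh w - Real.cosh (r * w))) w := by
      intro w
      have h1 : HasDerivAt (fun z : ℝ => r * z) r w := by
        simpa using (hasDerivAt_id w).const_mul r
      refine HasDerivAt.congr_deriv (((Real.hasDerivAt_sinh w).const_mul r).sub h1.sinh) ?_
      ring
    refine monotoneOn_of_deriv_nonneg (convex_Ici 0)
      (fun w _ => (hd w).continuousAt.continuousWithinAt)
      (fun w _ => (hd w).differentiableAt.differentiableWithinAt) ?_
    intro w hw
    rw [interior_Ici] at hw
    rw [(hd w).deriv]
    have hw' : 0 ≤ w := le_of_lt hw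
    refine mul_nonneg hr0 (sub_nonneg.2 (Real.cosh_le_cosh.2 ?_))
    rw [abs_of_nonneg hw', abs_of_nonneg (mul_nonneg hr0 hw')]
    nlinarith
  have := hmono (Set.mem_Ici.2 le_rfl) (Set.mem_Ici.2 hx) hx
  simp only [mul_zero, Real.sinh_zero, sub_zero] at this
  linarith

/-- The tangent line inequality for `cosh (r x)` as a concave function of `cosh x`. -/
theorem exists_cosh_mul_tangent {r : ℝ} (hr0 : 0 ≤ r) (hr1 : r ≤ 1) {D : ℝ} (hD : 0 ≤ D) :
    ∃ m : ℝ, ∀ x : ℝ, 0 ≤ x →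
      Real.cosh (r * x) ≤ Real.cosh (r * D) + m * (Real.cosh x - Real.cosh D) := by
  -- The slope of `cosh (r x)` with respect to `cosh x` is `r sinh (r x) / sinh x`, which decreases;
  -- `m` is its value at `D`, or its limit `r ^ 2` when `D = 0`.
  obtain ⟨m, hm⟩ : ∃ m : ℝ, (∀ x, 0 ≤ x → x ≤ D → m * Real.sinh x ≤ r * Real.sinh (r * x)) ∧
      (∀ x, D ≤ x → r * Real.sinh (r * x) ≤ m * Real.sinh x) := by
    rcases hD.eq_or_lt with rfl | hD0
    · refine ⟨r ^ 2, fun x hx hx' => ?_, fun x hx => ?_⟩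
      · obtain rfl : x = 0 := le_antisymm hx' hx
        simp
      · nlinarith [sinh_mul_le hr0 hr1 hx]
    · have hs := Real.sinh_pos_iff.2 hD0
      refine ⟨r * Real.sinh (r * D) / Real.sinh D, fun x hx hx' => ?_, fun x hx => ?_⟩
      · rw [div_mul_eq_mul_div, div_le_iff₀ hs]
        nlinarith [sinh_mul_ratio_antitone hr0 hr1 hx hx']
      · rw [div_mul_eq_mul_div, le_div_iff₀ hs]
        nlinarith [sinh_mul_ratio_antitone hr0 hr1 hD hx]
  refine ⟨m, fun x hx => ?_⟩
  have hd : ∀ w : ℝ, HasDerivAt (fun z : ℝ => Real.cosh (r * z) - m * Real.cosh z)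
      (r * Real.sinh (r * w) - m * Real.sinh w) w := by
    intro w
    have h1 : HasDerivAt (fun z : ℝ => r * z) r w := by
      simpa using (hasDerivAt_id w).const_mul r
    refine HasDerivAt.congr_deriv (h1.cosh.sub ((Real.hasDerivAt_cosh w).const_mul m)) ?_
    ring
  rcases le_total x D with hxD | hxD
  · have hmono : MonotoneOn (fun z : ℝ => Real.cosh (r * z) - m * Real.cosh z) (Set.Icc 0 D) := by
      refine monotoneOn_of_deriv_nonneg (convex_Icc 0 D)
        (fun w _ => (hd w).continuousAt.continuousWithinAt)
        (fun w _ => (hd w).differentiableAt.differentiableWithinAt) ?_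
      intro w hw
      have hw' := interior_subset hw
      rw [(hd w).deriv]
      linarith [hm.1 w hw'.1 hw'.2]
    have := hmono ⟨hx, hxD⟩ ⟨hD, le_rfl⟩ hxD
    simp only at this
    linarith
  · have hanti : AntitoneOn (fun z : ℝ => Real.cosh (r * z) - m * Real.cosh z) (Set.Ici D) := by
      refine antitoneOn_of_deriv_nonpos (convex_Ici D)
        (fun w _ => (hd w).continuousAt.continuousWithinAt)
        (fun w _ => (hd w).differentiableAt.differentiableWithinAt) ?_
      intro w hw
      rw [(hd w).deriv]
      linarith [hm.2 w (interior_subset hw)]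
    have := hanti (Set.mem_Ici.2 le_rfl) (Set.mem_Ici.2 hxD) hxD
    simp only at this
    linarith

/-- For `|c| ≤ 1` this is a convex combination of the values for the two degenerate triangles.
Convexity arguments in one variable thereby apply to the law of cosines. -/
theorem law_of_cosines_eq_average (a b c : ℝ) :
    Real.cosh a * Real.cosh b - c * (Real.sinh a * Real.sinh b) =
      (1 - c) / 2 * Real.cosh (a + b) + (1 + c) / 2 * Real.cosh |a - b| := by
  rw [Real.cosh_abs, Real.cosh_add, Real.cosh_sub]; ring

/-- Shrinking two sides of a hyperbolic triangle by the factor `r` shrinks the third side at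
least by the same factor. -/
theorem law_of_cosines_mul_le {r : ℝ} (hr0 : 0 ≤ r) (hr1 : r ≤ 1) {a b c D : ℝ} (ha : 0 ≤ a)
    (hb : 0 ≤ b) (hD : 0 ≤ D) (hc : |c| ≤ 1)
    (h : Real.cosh D = Real.cosh a * Real.cosh b - c * (Real.sinh a * Real.sinh b)) :
    Real.cosh (r * a) * Real.cosh (r * b) - c * (Real.sinh (r * a) * Real.sinh (r * b)) ≤
      Real.cosh (r * D) := by
  obtain ⟨m, hm⟩ := exists_cosh_mul_tangent hr0 hr1 hD
  obtain ⟨hc1, hc2⟩ := abs_le.1 hc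
  rw [law_of_cosines_eq_average] at h ⊢
  have e : |r * a - r * b| = r * |a - b| := by rw [← mul_sub, abs_mul, abs_of_nonneg hr0]
  rw [e, ← mul_add]
  -- Jensen's inequality, by averaging the tangent line bounds at `a + b` and `|a - b|`.
  have h1 := mul_le_mul_of_nonneg_left (hm (a + b) (by positivity))
    (show 0 ≤ (1 - c) / 2 by linarith)
  have h2 := mul_le_mul_of_nonneg_left (hm |a - b| (abs_nonneg _))
    (show 0 ≤ (1 + c) / 2 by linarith)
  linear_combination h1 + h2 - m * h

/-- The average of the tangent line inequalities for `exp` at `x` and at `-x`. -/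
theorem cosh_tangent_le (x y : ℝ) : Real.cosh x + Real.sinh x * (y - x) ≤ Real.cosh y := by
  have h1 := Real.add_one_le_exp (y - x)
  have h2 := Real.add_one_le_exp (x - y)
  have e1 : Real.exp y = Real.exp x * Real.exp (y - x) := by rw [← Real.exp_add]; ring_nf
  have e2 : Real.exp (-y) = Real.exp (-x) * Real.exp (x - y) := by rw [← Real.exp_add]; ring_nf
  have h3 := mul_le_mul_of_nonneg_left h1 (Real.exp_pos x).le
  have h4 := mul_le_mul_of_nonneg_left h2 (Real.exp_pos (-x)).le
  rw [← e1] at h3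
  rw [← e2] at h4
  rw [Real.cosh_eq, Real.cosh_eq, Real.sinh_eq]
  linarith

/-- If lengthening the two sides `a ≤ b` of a hyperbolic triangle does not lengthen the third
side, then the angle at the endpoint of the side `a` is not acute. -/
theorem sinh_mul_cosh_le_of_lengthen {a b A B c : ℝ} (ha : 0 < a) (hab : a ≤ b) (hA : a < A)
    (hB : b < B) (hc : |c| ≤ 1)
    (h : Real.cosh A * Real.cosh B - c * (Real.sinh A * Real.sinh B) ≤
      Real.cosh a * Real.cosh b - c * (Real.sinh a * Real.sinh b)) :
    Real.sinh a * Real.cosh b ≤ c * (Real.cosh a * Real.sinh b) := by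
  obtain ⟨hc1, hc2⟩ := abs_le.1 hc
  by_contra! hlt
  have hsa := Real.sinh_pos_iff.2 ha
  have hsb := Real.sinh_pos_iff.2 (ha.trans_le hab)
  have hca := Real.cosh_pos a
  have hcb := Real.cosh_pos b
  have hba : 0 ≤ Real.sinh (b - a) := Real.sinh_nonneg_iff.2 (by linarith)
  rw [Real.sinh_sub] at hba
  -- The law of cosines is a convex function of the pair of sides. Its partial derivatives at `(a,
  -- b)` are the positive quantity from `hlt` and this one, so lengthening both sides would increase
  -- it strictly.
  have hsecond : 0 ≤ Real.cosh a * Real.sinh b - c * (Real.sinh a * Real.cosh b) := by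
    nlinarith [mul_pos hsa hcb]
  have t1 := mul_le_mul_of_nonneg_left (cosh_tangent_le (a + b) (A + B))
    (show 0 ≤ (1 - c) / 2 by linarith)
  have t2 := mul_le_mul_of_nonneg_left (cosh_tangent_le (a - b) (A - B))
    (show 0 ≤ (1 + c) / 2 by linarith)
  rw [law_of_cosines_eq_average, law_of_cosines_eq_average, Real.cosh_abs, Real.cosh_abs] at h
  have e : (1 - c) / 2 * (Real.sinh (a + b) * (A + B - (a + b))) +
      (1 + c) / 2 * (Real.sinh (a - b) * (A - B - (a - b))) =
      (A - a) * (Real.sinh a * Real.cosh b - c * (Real.cosh a * Real.sinh b)) +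
      (B - b) * (Real.cosh a * Real.sinh b - c * (Real.sinh a * Real.cosh b)) := by
    rw [Real.sinh_add, Real.sinh_sub]; ring
  have p1 := mul_pos (sub_pos.2 hA) (sub_pos.2 hlt)
  have p2 := mul_nonneg (sub_pos.2 hB).le hsecond
  linarith

/-- The cosine of an angle in a triangle with given sides. -/
theorem exists_law_of_cosines {A B D : ℝ} (hA : 0 < A) (hB : 0 < B) (hD : 0 ≤ D)
    (h1 : D ≤ A + B) (h2 : |A - B| ≤ D) :
    ∃ c : ℝ, |c| ≤ 1 ∧
      Real.cosh D = Real.cosh A * Real.cosh B - c * (Real.sinh A * Real.sinh B) := by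
  have hs : 0 < Real.sinh A * Real.sinh B :=
    mul_pos (Real.sinh_pos_iff.2 hA) (Real.sinh_pos_iff.2 hB)
  have u1 : Real.cosh D ≤ Real.cosh (A + B) := by
    rw [Real.cosh_le_cosh, abs_of_nonneg hD, abs_of_nonneg (by linarith)]; exact h1
  have u2 : Real.cosh (A - B) ≤ Real.cosh D := by
    rw [Real.cosh_le_cosh, abs_of_nonneg hD]; exact h2
  rw [Real.cosh_add] at u1
  rw [Real.cosh_sub] at u2
  refine ⟨(Real.cosh A * Real.cosh B - Real.cosh D) / (Real.sinh A * Real.sinh B), ?_, ?_⟩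
  · rw [abs_le, le_div_iff₀ hs, div_le_iff₀ hs]
    constructor <;> linarith
  · rw [div_mul_cancel₀ _ hs.ne']; ring

/-! ### The model plane -/

/-- Cauchy–Schwarz for `(1, u₀, u₁)` and `(1, v₀, v₁)`, whose norms are `u₂` and `v₂`. -/
theorem ModelPlane.one_le_neg_form {κ : ℝ} (u v : ModelPlane κ) :
    1 ≤ -lorentzForm u.vec v.vec := by
  have hu := u.form_self
  have hv := v.form_self
  have hu1 := u.one_le
  have hv1 := v.one_le
  unfold lorentzForm at *
  have hpos : 0 ≤ u.vec 2 * v.vec 2 := by positivity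
  have hsq : (1 + (u.vec 0 * v.vec 0 + u.vec 1 * v.vec 1)) ^ 2 ≤ (u.vec 2 * v.vec 2) ^ 2 := by
    have e : (u.vec 2 * v.vec 2) ^ 2 = (1 + u.vec 0 ^ 2 + u.vec 1 ^ 2) *
        (1 + v.vec 0 ^ 2 + v.vec 1 ^ 2) := by
      rw [show 1 + u.vec 0 ^ 2 + u.vec 1 ^ 2 = u.vec 2 ^ 2 by linarith,
        show 1 + v.vec 0 ^ 2 + v.vec 1 ^ 2 = v.vec 2 ^ 2 by linarith]
      ring
    rw [e]
    nlinarith [sq_nonneg (u.vec 0 - v.vec 0), sq_nonneg (u.vec 1 - v.vec 1),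
      sq_nonneg (u.vec 0 * v.vec 1 - u.vec 1 * v.vec 0)]
  linarith [(le_abs_self _).trans (abs_le_of_sq_le_sq hsq hpos)]

theorem ModelPlane.ext_vec {κ : ℝ} {u v : ModelPlane κ} (h : u.vec = v.vec) : u = v := by
  cases u; cases v; simp only at h; subst h; rfl

/-- Equality in Cauchy–Schwarz: by Lagrange's identity the defect is `(u₀ - v₀)² + (u₁ - v₁)² +
(u₀v₁ - u₁v₀)²`. -/
theorem ModelPlane.eq_of_neg_form_eq_one {κ : ℝ} {u v : ModelPlane κ}
    (h : -lorentzForm u.vec v.vec = 1) : u = v := by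
  have hu := u.form_self
  have hv := v.form_self
  have hu1 := u.one_le
  have hv1 := v.one_le
  unfold lorentzForm at *
  have e : (1 + (u.vec 0 * v.vec 0 + u.vec 1 * v.vec 1)) ^ 2 = (1 + u.vec 0 ^ 2 + u.vec 1 ^ 2) *
        (1 + v.vec 0 ^ 2 + v.vec 1 ^ 2) := by
    rw [show 1 + u.vec 0 ^ 2 + u.vec 1 ^ 2 = u.vec 2 ^ 2 by linarith,
      show 1 + v.vec 0 ^ 2 + v.vec 1 ^ 2 = v.vec 2 ^ 2 by linarith,
      show 1 + (u.vec 0 * v.vec 0 + u.vec 1 * v.vec 1) = u.vec 2 * v.vec 2 by linarith]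
    ring
  have h0 : u.vec 0 = v.vec 0 := by
    have : (u.vec 0 - v.vec 0) ^ 2 = 0 := by
      nlinarith [sq_nonneg (u.vec 0 - v.vec 0), sq_nonneg (u.vec 1 - v.vec 1),
        sq_nonneg (u.vec 0 * v.vec 1 - u.vec 1 * v.vec 0)]
    exact sub_eq_zero.1 (pow_eq_zero_iff two_ne_zero |>.1 this)
  have h1 : u.vec 1 = v.vec 1 := by
    have : (u.vec 1 - v.vec 1) ^ 2 = 0 := by
      nlinarith [sq_nonneg (u.vec 0 - v.vec 0), sq_nonneg (u.vec 1 - v.vec 1),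
        sq_nonneg (u.vec 0 * v.vec 1 - u.vec 1 * v.vec 0)]
    exact sub_eq_zero.1 (pow_eq_zero_iff two_ne_zero |>.1 this)
  have h2 : u.vec 2 = v.vec 2 := by
    rw [h0, h1] at hu
    have : u.vec 2 ^ 2 = v.vec 2 ^ 2 := by linarith
    exact (pow_left_inj₀ (by linarith) (by linarith) two_ne_zero).1 this
  apply ModelPlane.ext_vec
  funext i
  fin_cases i
  · exact h0
  · exact h1
  · exact h2

theorem ModelPlane.dist_nonneg' {κ : ℝ} (u v : ModelPlane κ) : 0 ≤ dist u v :=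
  mul_nonneg (by positivity) (Real.arcosh_nonneg (u.one_le_neg_form v))

theorem ModelPlane.cosh_dist {κ : ℝ} (hκ : κ < 0) (u v : ModelPlane κ) :
    Real.cosh (√(-κ) * dist u v) = -lorentzForm u.vec v.vec := by
  have hk : √(-κ) ≠ 0 := (Real.sqrt_pos.2 (neg_pos.2 hκ)).ne'
  have : √(-κ) * dist u v = Real.arcosh (-lorentzForm u.vec v.vec) := by
    show √(-κ) * (1 / √(-κ) * _) = _
    field_simp
  rw [this, Real.cosh_arcosh (u.one_le_neg_form v)]

theorem ModelPlane.dist_eq_of_neg_form {κ : ℝ} (hκ : κ < 0) {u v : ModelPlane κ} {d : ℝ}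
    (hd : 0 ≤ d) (h : -lorentzForm u.vec v.vec = Real.cosh (√(-κ) * d)) : dist u v = d := by
  have hk : √(-κ) ≠ 0 := (Real.sqrt_pos.2 (neg_pos.2 hκ)).ne'
  show 1 / √(-κ) * Real.arcosh _ = d
  rw [h, Real.arcosh_cosh (by positivity)]
  field_simp

/-- The geodesic segments of the model plane, in hyperboloid coordinates. -/
theorem ModelPlane.exists_geodesic {κ : ℝ} (hκ : κ < 0) (u v : ModelPlane κ) :
    ∃ c : ℝ → ModelPlane κ, c 0 = u ∧ c (dist u v) = v ∧
      IsGeodesicOn c (Set.Icc 0 (dist u v)) ∧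
      ∀ t ∈ Set.Icc 0 (dist u v), ∀ i, Real.sinh (√(-κ) * dist u v) * (c t).vec i =
        Real.sinh (√(-κ) * dist u v - √(-κ) * t) * u.vec i + Real.sinh (√(-κ) * t) * v.vec i := by
  have hk : 0 < √(-κ) := Real.sqrt_pos.2 (neg_pos.2 hκ)
  have hcosh := ModelPlane.cosh_dist hκ u v
  rcases (u.dist_nonneg' v).eq_or_lt with hD | hD
  · rw [← hD, mul_zero, Real.cosh_zero] at hcosh
    obtain rfl := ModelPlane.eq_of_neg_form_eq_one hcosh.symm
    rw [← hD]
    refine ⟨fun _ => u, rfl, rfl, ?_, ?_⟩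
    · intro s hs t ht
      rw [Set.Icc_self] at hs ht
      rw [Set.mem_singleton_iff.1 hs, Set.mem_singleton_iff.1 ht, ← hD]
      simp
    · intro t ht i
      rw [Set.Icc_self] at ht
      rw [Set.mem_singleton_iff.1 ht]
      simp
  set D := dist u v
  set k := √(-κ)
  have hsD : 0 < Real.sinh (k * D) := Real.sinh_pos_iff.2 (by positivity)
  let w : ℝ → Fin 3 → ℝ := fun t i => (Real.sinh (k * D - k * t) * u.vec i +
    Real.sinh (k * t) * v.vec i) / Real.sinh (k * D)
  have hform : ∀ s t : ℝ, lorentzForm (w s) (w t) = -Real.cosh (k * (s - t)) := by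
    intro s t
    have hu := u.form_self
    have hv := v.form_self
    have key := sinh_sub_combination (k * D) (k * s) (k * t)
    rw [← mul_sub k s t] at key
    simp only [lorentzForm, w] at *
    generalize Real.sinh (k * D - k * s) = ms at *
    generalize Real.sinh (k * D - k * t) = mt at *
    generalize Real.sinh (k * s) = ss at *
    generalize Real.sinh (k * t) = st at *
    generalize Real.cosh (k * (s - t)) = cst at *
    field_simp
    linear_combination ms * mt * hu + ss * st * hv - key + (ms * st + ss * mt) * hcosh
  have hone : ∀ t ∈ Set.Icc 0 D, 1 ≤ w t 2 := by
    intro t ht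
    have h1 := hform t t
    rw [sub_self, mul_zero, Real.cosh_zero] at h1
    have hu := u.one_le
    have hv := v.one_le
    have hnn : 0 ≤ w t 2 := by
      have n1 : 0 ≤ Real.sinh (k * D - k * t) := by
        rw [Real.sinh_nonneg_iff, ← mul_sub]
        exact mul_nonneg hk.le (sub_nonneg.2 ht.2)
      have n2 : 0 ≤ Real.sinh (k * t) := Real.sinh_nonneg_iff.2 (mul_nonneg hk.le ht.1)
      exact div_nonneg (by positivity) hsD.le
    unfold lorentzForm at h1
    nlinarith [sq_nonneg (w t 0), sq_nonneg (w t 1)]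
  have hself : ∀ t, lorentzForm (w t) (w t) = -1 := by
    intro t; rw [hform, sub_self, mul_zero, Real.cosh_zero]
  classical
  -- Membership in the upper sheet is established only on `[0, D]`; the value `u` elsewhere plays no
  -- role.
  let c : ℝ → ModelPlane κ := fun t =>
    if ht : t ∈ Set.Icc 0 D then ⟨w t, hself t, hone t ht⟩ else u
  have hc : ∀ t ∈ Set.Icc 0 D, (c t).vec = w t := by
    intro t ht
    simp only [c, dif_pos ht]
  refine ⟨c, ?_, ?_, ?_, ?_⟩
  · apply ModelPlane.ext_vec
    rw [hc 0 ⟨le_rfl, hD.le⟩]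
    funext i
    simp only [w, mul_zero, sub_zero, Real.sinh_zero, zero_mul, add_zero]
    field_simp
  · apply ModelPlane.ext_vec
    rw [hc D ⟨hD.le, le_rfl⟩]
    funext i
    simp only [w, sub_self, Real.sinh_zero, zero_mul, zero_add]
    field_simp
  · intro s hs t ht
    apply ModelPlane.dist_eq_of_neg_form hκ (abs_nonneg _)
    rw [hc s hs, hc t ht, hform, neg_neg, ← Real.cosh_abs, abs_mul, abs_of_pos hk]
  · intro t ht i
    rw [hc t ht]
    simp only [w]
    field_simp

/-! ### Comparison for hinges in CAT(κ) spaces -/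

theorem IsGeodesicOn.dist_left {X : Type*} [MetricSpace X] {p u : X} {g : ℝ → X} (g0 : g 0 = p)
    (hg : IsGeodesicOn g (Set.Icc 0 (dist p u))) {s : ℝ} (hs : s ∈ Set.Icc 0 (dist p u)) :
    dist p (g s) = s := by
  rw [← g0, hg 0 ⟨le_rfl, dist_nonneg⟩ s hs, zero_sub, abs_neg, abs_of_nonneg hs.1]

theorem IsMetricSegment.reverse {X : Type*} [MetricSpace X] {x y : X} {c : ℝ → X}
    (h0 : c 0 = x) (h1 : c (dist x y) = y) (hc : IsGeodesicOn c (Set.Icc 0 (dist x y))) :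
    IsMetricSegment y x (c '' Set.Icc 0 (dist x y)) := by
  refine ⟨fun t => c (dist x y - t), by simp [h1], by simp [h0, dist_comm y x], ?_, ?_⟩
  · intro s hs t ht
    rw [dist_comm y x] at hs ht
    rw [hc _ ⟨sub_nonneg.2 hs.2, by linarith [hs.1]⟩ _ ⟨sub_nonneg.2 ht.2, by linarith [ht.1]⟩,
      sub_sub_sub_cancel_left, abs_sub_comm]
  · rw [dist_comm y x]
    ext z
    constructor
    · rintro ⟨t, ht, rfl⟩
      exact ⟨dist x y - t, ⟨sub_nonneg.2 ht.2, by linarith [ht.1]⟩, by simp⟩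
    · rintro ⟨t, ht, rfl⟩
      exact ⟨dist x y - t, ⟨sub_nonneg.2 ht.2, by linarith [ht.1]⟩, rfl⟩

/-- Three points of the model plane forming a hinge with sides `A`, `B` and angle cosine `c`. -/
theorem ModelPlane.exists_hinge {κ : ℝ} (hκ : κ < 0) {A B D c : ℝ} (hA : 0 ≤ A) (hB : 0 ≤ B)
    (hD : 0 ≤ D) (hc : |c| ≤ 1)
    (h : Real.cosh (√(-κ) * D) = Real.cosh (√(-κ) * A) * Real.cosh (√(-κ) * B) -
      c * (Real.sinh (√(-κ) * A) * Real.sinh (√(-κ) * B))) :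
    ∃ p u v : ModelPlane κ, dist p u = A ∧ dist v p = B ∧ dist u v = D := by
  have hc2 : 0 ≤ 1 - c ^ 2 := by
    have := (sq_le_one_iff_abs_le_one c).2 hc
    linarith
  set k := √(-κ)
  have hcA := Real.cosh_sq (k * A)
  have hcB := Real.cosh_sq (k * B)
  have hs := Real.sq_sqrt hc2
  -- Polar coordinates about the lowest point of the hyperboloid, with `c` and `√(1 - c ^ 2)` as
  -- cosine and sine of the angle.
  refine ⟨⟨![0, 0, 1], by simp [lorentzForm], by simp⟩,
    ⟨![Real.sinh (k * A), 0, Real.cosh (k * A)], ?_, by simp⟩,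
    ⟨![c * Real.sinh (k * B), √(1 - c ^ 2) * Real.sinh (k * B), Real.cosh (k * B)], ?_,
      by simp⟩, ?_, ?_, ?_⟩
  · simp [lorentzForm]; linarith
  · simp [lorentzForm]
    linear_combination Real.sinh (k * B) ^ 2 * hs - hcB
  · apply ModelPlane.dist_eq_of_neg_form hκ hA
    simp [lorentzForm, k]
  · apply ModelPlane.dist_eq_of_neg_form hκ hB
    simp [lorentzForm, k]
  · apply ModelPlane.dist_eq_of_neg_form hκ hD
    simp only [k] at *
    rw [h]
    simp [lorentzForm]
    ring

/-- The CAT(κ) inequality for two sides issuing from a common vertex, expressed through the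
cosine of the comparison angle. -/
theorem IsCAT.exists_comparison_cos {X : Type*} [MetricSpace X] {κ : ℝ} (hκ : κ < 0)
    (hX : IsCAT κ X) {p u v : X} {g h : ℝ → X}
    (g0 : g 0 = p) (g1 : g (dist p u) = u) (hg : IsGeodesicOn g (Set.Icc 0 (dist p u)))
    (h0 : h 0 = p) (h1 : h (dist p v) = v) (hh : IsGeodesicOn h (Set.Icc 0 (dist p v))) :
    ∃ c : ℝ, |c| ≤ 1 ∧
      Real.cosh (√(-κ) * dist u v) =
        Real.cosh (√(-κ) * dist p u) * Real.cosh (√(-κ) * dist p v) -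
          c * (Real.sinh (√(-κ) * dist p u) * Real.sinh (√(-κ) * dist p v)) ∧
      ∀ s ∈ Set.Icc 0 (dist p u), ∀ t ∈ Set.Icc 0 (dist p v),
        Real.cosh (√(-κ) * dist (g s) (h t)) ≤ Real.cosh (√(-κ) * s) * Real.cosh (√(-κ) * t) -
          c * (Real.sinh (√(-κ) * s) * Real.sinh (√(-κ) * t)) := by
  have hk : 0 < √(-κ) := Real.sqrt_pos.2 (neg_pos.2 hκ)
  have hgp : ∀ s ∈ Set.Icc 0 (dist p u), dist p (g s) = s := fun s hs => hg.dist_left g0 hs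
  have hhp : ∀ t ∈ Set.Icc 0 (dist p v), dist p (h t) = t := fun t ht => hh.dist_left h0 ht
  rcases (dist_nonneg (x := p) (y := u)).eq_or_lt with hA | hA
  · obtain rfl : p = u := dist_eq_zero.1 hA.symm
    -- A degenerate side has no angle; `c` is multiplied by `sinh 0`, so any value in `[-1, 1]`
    -- would do.
    refine ⟨1, by simp, by simp, fun s hs t ht => ?_⟩
    rw [← hA, Set.Icc_self] at hs
    obtain rfl := Set.mem_singleton_iff.1 hs
    rw [g0, hhp t ht]
    simp
  rcases (dist_nonneg (x := p) (y := v)).eq_or_lt with hB | hB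
  · obtain rfl : p = v := dist_eq_zero.1 hB.symm
    refine ⟨1, by simp, by simp [dist_comm], fun s hs t ht => ?_⟩
    rw [← hB, Set.Icc_self] at ht
    obtain rfl := Set.mem_singleton_iff.1 ht
    rw [h0, dist_comm, hgp s hs]
    simp
  obtain ⟨c, hc, hlaw⟩ := exists_law_of_cosines (A := √(-κ) * dist p u) (B := √(-κ) * dist p v)
    (D := √(-κ) * dist u v) (by positivity) (by positivity) (by positivity)
    (by rw [← mul_add]; gcongr; rw [dist_comm p u]; exact dist_triangle u p v)
    (by
      rw [← mul_sub, abs_mul, abs_of_pos hk, dist_comm p u, dist_comm p v]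
      gcongr
      exact abs_dist_sub_le u v p)
  refine ⟨c, hc, hlaw, fun s hs t ht => ?_⟩
  obtain ⟨p', u', v', hA', hB', hD'⟩ := ModelPlane.exists_hinge hκ hA.le hB.le dist_nonneg hc hlaw
  obtain ⟨S, hS⟩ := hX.1 u v
  obtain ⟨γ, γ0, γ1, hγ, γvec⟩ := ModelPlane.exists_geodesic hκ p' u'
  obtain ⟨η, η0, η1, hη, ηvec⟩ := ModelPlane.exists_geodesic hκ v' p'
  obtain ⟨σ, σ0, σ1, hσ, -⟩ := ModelPlane.exists_geodesic hκ u' v'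
  have hs' : s ∈ Set.Icc 0 (dist p' u') := by rwa [hA']
  -- The third edge of a triangle runs from `v` back to `p`, so `h t` has parameter `dist p v - t`
  -- on it.
  have ht' : dist p v - t ∈ Set.Icc 0 (dist v' p') := by
    rw [hB']; exact ⟨sub_nonneg.2 ht.2, by linarith [ht.1]⟩
  let Δ : GeodesicTriangle X := ⟨p, u, v, g '' Set.Icc 0 (dist p u), S, h '' Set.Icc 0 (dist p v),
    ⟨g, g0, g1, hg, rfl⟩, hS, IsMetricSegment.reverse h0 h1 hh⟩
  let Δ' : GeodesicTriangle (ModelPlane κ) := ⟨p', u', v', γ '' Set.Icc 0 (dist p' u'),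
    σ '' Set.Icc 0 (dist u' v'), η '' Set.Icc 0 (dist v' p'),
    ⟨γ, γ0, γ1, hγ, rfl⟩, ⟨σ, σ0, σ1, hσ, rfl⟩, ⟨η, η0, η1, hη, rfl⟩⟩
  have hle : dist (g s) (h t) ≤ dist (γ s) (η (dist p v - t)) := by
    refine hX.2 Δ Δ' ⟨hA', hD', hB'.trans (dist_comm p v)⟩ _ _ _ _
      (Or.inl ⟨⟨s, hs, rfl⟩, ⟨s, hs', rfl⟩, ?_⟩)
      (Or.inr (Or.inr ⟨⟨t, ht, rfl⟩, ⟨_, ht', rfl⟩, ?_⟩))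
    · show dist p' (γ s) = dist p (g s)
      rw [hgp s hs, ← γ0, hγ 0 ⟨le_rfl, ModelPlane.dist_nonneg' _ _⟩ s hs', zero_sub, abs_neg,
        abs_of_nonneg hs.1]
    · show dist v' (η (dist p v - t)) = dist v (h t)
      conv_rhs => rw [← h1]
      rw [hh _ ⟨dist_nonneg, le_rfl⟩ t ht, ← η0,
        hη 0 ⟨le_rfl, ModelPlane.dist_nonneg' _ _⟩ _ ht', zero_sub, abs_neg]
  have hle' : Real.cosh (√(-κ) * dist (g s) (h t)) ≤
      -lorentzForm (γ s).vec (η (dist p v - t)).vec := by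
    rw [← ModelPlane.cosh_dist hκ, Real.cosh_le_cosh, abs_of_nonneg (by positivity),
      abs_of_nonneg (mul_nonneg hk.le (ModelPlane.dist_nonneg' _ _))]
    gcongr
  refine hle'.trans (le_of_eq ?_)
  have ea := γvec s hs'
  have eb := ηvec _ ht'
  rw [hA'] at ea
  rw [hB', mul_sub, sub_sub_cancel] at eb
  have fA := ModelPlane.cosh_dist hκ p' u'
  have fB := ModelPlane.cosh_dist hκ v' p'
  have fD := ModelPlane.cosh_dist hκ u' v'
  have fp := p'.form_self
  rw [hA'] at fA
  rw [hB'] at fB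
  rw [hD', hlaw] at fD
  have iA := sinh_sub_add_sinh_mul_cosh (√(-κ) * dist p u) (√(-κ) * s)
  have iB := sinh_sub_add_sinh_mul_cosh (√(-κ) * dist p v) (√(-κ) * t)
  have sA : 0 < Real.sinh (√(-κ) * dist p u) := Real.sinh_pos_iff.2 (by positivity)
  have sB : 0 < Real.sinh (√(-κ) * dist p v) := Real.sinh_pos_iff.2 (by positivity)
  -- With denominators cleared, both points are explicit combinations of `p'`, `u'`, `v'`, and
  -- bilinearity reduces the claim to the forms of these vertices.
  refine mul_left_cancel₀ (mul_pos sA sB).ne' ?_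
  have expand : Real.sinh (√(-κ) * dist p u) * Real.sinh (√(-κ) * dist p v) *
      -lorentzForm (γ s).vec (η (dist p v - t)).vec =
      -lorentzForm (fun i => Real.sinh (√(-κ) * dist p u) * (γ s).vec i)
        (fun i => Real.sinh (√(-κ) * dist p v) * (η (dist p v - t)).vec i) := by
    unfold lorentzForm; ring
  rw [expand, funext ea, funext eb]
  generalize Real.sinh (√(-κ) * dist p u) = SA at *
  generalize Real.sinh (√(-κ) * dist p v) = SB at *
  generalize Real.cosh (√(-κ) * dist p u) = CA at *
  generalize Real.cosh (√(-κ) * dist p v) = CB at *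
  generalize Real.sinh (√(-κ) * dist p u - √(-κ) * s) = mA at *
  generalize Real.sinh (√(-κ) * dist p v - √(-κ) * t) = mB at *
  generalize Real.sinh (√(-κ) * s) = ss at *
  generalize Real.sinh (√(-κ) * t) = st at *
  generalize Real.cosh (√(-κ) * s) = cs at *
  generalize Real.cosh (√(-κ) * t) = ct at *
  unfold lorentzForm at *
  linear_combination (-(mA * mB)) * fp - mB * ss * fA - mA * st * fB - ss * st * fD +
    SB * ct * iA + (mA + ss * CA) * iB

/-! ### Shifting along a ray -/

/-- A set containing an infinite geodesic admits a nonexpansive mapping without fixed points: the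
Busemann function of the ray followed by a shift along the ray. -/
theorem IsGeodesicallyBounded.of_hasNonexpansiveFPP {X : Type*} [MetricSpace X] {K : Set X}
    (hK : HasNonexpansiveFPP K) : IsGeodesicallyBounded K := by
  rintro ⟨c, hc, hcK⟩
  -- The terms are nondecreasing in `n`, so the supremum stands for the limit in the Busemann
  -- function (here with reversed sign).
  let b : X → ℝ := fun x => ⨆ n : ℕ, ((n : ℝ) - dist x (c n))
  have hbdd : ∀ x, BddAbove (Set.range fun n : ℕ => ((n : ℝ) - dist x (c n))) := by
    intro x
    refine ⟨dist (c 0) x, ?_⟩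
    rintro _ ⟨n, rfl⟩
    have h1 : dist (c 0) (c n) = n := by
      rw [hc 0 (Set.mem_Ici.2 le_rfl) n (Set.mem_Ici.2 n.cast_nonneg), zero_sub, abs_neg,
        abs_of_nonneg n.cast_nonneg]
    have h2 := dist_triangle (c 0) x (c n)
    simp only
    linarith
  have hlip : ∀ x y, b x ≤ b y + dist x y := by
    intro x y
    refine ciSup_le fun n => ?_
    have h1 : (n : ℝ) - dist y (c n) ≤ b y := le_ciSup (hbdd y) n
    have h2 := dist_triangle y x (c n)
    rw [dist_comm y x] at h2
    linarith
  have hray : ∀ s, 0 ≤ s → b (c s) = s := by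
    intro s hs
    have hd : ∀ n : ℕ, dist (c s) (c n) = |s - n| := fun n =>
      hc s (Set.mem_Ici.2 hs) n (Set.mem_Ici.2 n.cast_nonneg)
    refine le_antisymm (ciSup_le fun n => ?_) ?_
    · rw [hd]
      linarith [neg_abs_le (s - n)]
    · obtain ⟨n, hn⟩ := exists_nat_ge s
      have h1 : (n : ℝ) - dist (c s) (c n) ≤ b (c s) := le_ciSup (hbdd (c s)) n
      rw [hd, abs_of_nonpos (by linarith)] at h1
      linarith
  -- Truncation at 0 keeps the parameter on the ray; a fixed point would satisfy `b x = max (b x) 0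
  -- + 1`.
  have hpos : ∀ x, 0 ≤ max (b x) 0 + 1 := fun x => by positivity
  obtain ⟨x, hx⟩ := hK (fun x => ⟨c (max (b x) 0 + 1), hcK _ (hpos x)⟩) (by
    intro x y
    show dist (c _) (c _) ≤ dist (x : X) y
    rw [hc _ (hpos x) _ (hpos y), add_sub_add_right_eq_sub]
    refine (abs_max_sub_max_le_abs _ _ _).trans (abs_le.2 ⟨?_, ?_⟩)
    · linarith [hlip y x, dist_comm (x : X) y]
    · linarith [hlip x y])
  have hx' : c (max (b x) 0 + 1) = x := congrArg Subtype.val hx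
  have h1 := hray _ (hpos x)
  rw [hx'] at h1
  linarith [le_max_left (b x) 0]

/-! ### Points fixed by a nonexpansive mapping composed with a contraction towards a point -/

theorem mul_mem_Icc_zero {r A : ℝ} (hr0 : 0 ≤ r) (hr1 : r ≤ 1) (hA : 0 ≤ A) :
    r * A ∈ Set.Icc 0 A :=
  ⟨mul_nonneg hr0 hA, mul_le_of_le_one_left hA hr1⟩

/-- Contracting two segments from a common point by a factor `r`. -/
theorem IsCAT.dist_mul_le {X : Type*} [MetricSpace X] {κ : ℝ} (hκ : κ < 0)
    (hX : IsCAT κ X) {p u v : X} {g h : ℝ → X}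
    (g0 : g 0 = p) (g1 : g (dist p u) = u) (hg : IsGeodesicOn g (Set.Icc 0 (dist p u)))
    (h0 : h 0 = p) (h1 : h (dist p v) = v) (hh : IsGeodesicOn h (Set.Icc 0 (dist p v)))
    {r : ℝ} (hr0 : 0 ≤ r) (hr1 : r ≤ 1) :
    dist (g (r * dist p u)) (h (r * dist p v)) ≤ r * dist u v := by
  have hk : 0 < √(-κ) := Real.sqrt_pos.2 (neg_pos.2 hκ)
  obtain ⟨c, hc, hlaw, hcomp⟩ := hX.exists_comparison_cos hκ g0 g1 hg h0 h1 hh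
  have h2 := hcomp _ (mul_mem_Icc_zero hr0 hr1 dist_nonneg) _
    (mul_mem_Icc_zero hr0 hr1 dist_nonneg)
  have h3 := law_of_cosines_mul_le hr0 hr1 (by positivity) (by positivity) (by positivity) hc hlaw
  simp only [mul_left_comm r] at h3
  have h4 := h2.trans h3
  rw [Real.cosh_le_cosh, abs_of_nonneg (by positivity), abs_of_nonneg (by positivity)] at h4
  exact le_of_mul_le_mul_left h4 hk

section

variable {X : Type*} [MetricSpace X] {κ : ℝ} {p : X} {G : X → ℝ → X}

/-- Banach's theorem for `T` followed by the contraction towards `p`, which is `r`-Lipschitz by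
`IsCAT.dist_mul_le`. `G u` is a chosen segment from `p` to `u`. -/
theorem exists_eq_contraction [CompleteSpace X] (hκ : κ < 0) (hX : IsCAT κ X)
    (hG : ∀ u, G u 0 = p ∧ G u (dist p u) = u ∧ IsGeodesicOn (G u) (Set.Icc 0 (dist p u)))
    {K : Set X} (hclosed : IsClosed K)
    (hGK : ∀ u ∈ K, ∀ s ∈ Set.Icc 0 (dist p u), G u s ∈ K) (hp : p ∈ K) {T : K → K}
    (hT : ∀ x y : K, dist (T x) (T y) ≤ dist x y) {r : ℝ} (hr0 : 0 ≤ r) (hr1 : r < 1) :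
    ∃ x : K, G (T x) (r * dist p (T x)) = x := by
  have : CompleteSpace K := hclosed.completeSpace_coe
  have : Nonempty K := ⟨⟨p, hp⟩⟩
  let F : K → K := fun x => ⟨G (T x) (r * dist p (T x)),
    hGK _ (T x).2 _ (mul_mem_Icc_zero hr0 hr1.le dist_nonneg)⟩
  have hF : ContractingWith ⟨r, hr0⟩ F := by
    refine ⟨hr1, LipschitzWith.of_dist_le_mul fun x y => ?_⟩
    obtain ⟨g0, g1, hg⟩ := hG (T x)
    obtain ⟨h0, h1, hh⟩ := hG (T y)
    exact (hX.dist_mul_le hκ g0 g1 hg h0 h1 hh hr0 hr1.le).trans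
      (mul_le_mul_of_nonneg_left (hT x y) hr0)
  exact ⟨hF.fixedPoint, congrArg Subtype.val hF.fixedPoint_isFixedPt⟩

/-- Estimates for two points `x`, `y` in the interior of segments `[p, u]`, `[p, v]` whose
endpoints are at most as far apart as `x` and `y`. -/
theorem IsCAT.cosh_dist_le_of_dist_le (hκ : κ < 0) (hX : IsCAT κ X)
    (hG : ∀ u, G u 0 = p ∧ G u (dist p u) = u ∧ IsGeodesicOn (G u) (Set.Icc 0 (dist p u)))
    {u v : X} {a b : ℝ} (ha : 0 < a) (hb : 0 < b) (hau : a < dist p u) (hbv : b < dist p v)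
    (huv : dist u v ≤ dist (G u a) (G v b)) :
    Real.cosh (√(-κ) * dist (G u a) (G v b)) ≤
        1 + |Real.cosh (√(-κ) * a) - Real.cosh (√(-κ) * b)| ∧
      ∀ s, 0 ≤ s → s ≤ a → s ≤ b → Real.cosh (√(-κ) * dist (G u s) (G v s)) ≤
        1 + Real.sinh (√(-κ) * s) ^ 2 * (Real.exp (-(√(-κ) * a)) + Real.exp (-(√(-κ) * b))) := by
  have hk : 0 < √(-κ) := Real.sqrt_pos.2 (neg_pos.2 hκ)
  -- The absolute value and the sum of two exponentials make the claim symmetric.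
  wlog hab : a ≤ b generalizing a b u v
  · have := this hb ha hbv hau (by rwa [dist_comm, dist_comm (G v b)]) (le_of_not_ge hab)
    rw [dist_comm, abs_sub_comm]
    refine ⟨this.1, fun s hs hsa hsb => ?_⟩
    rw [dist_comm, add_comm (Real.exp _)]
    exact this.2 s hs hsb hsa
  obtain ⟨g0, g1, hg⟩ := hG u
  obtain ⟨h0, h1, hh⟩ := hG v
  obtain ⟨c, hc, hlaw, hcomp⟩ := hX.exists_comparison_cos hκ g0 g1 hg h0 h1 hh
  have hxy := hcomp a ⟨ha.le, hau.le⟩ b ⟨hb.le, hbv.le⟩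
  have hle : Real.cosh (√(-κ) * dist u v) ≤ Real.cosh (√(-κ) * dist (G u a) (G v b)) := by
    rw [Real.cosh_le_cosh, abs_of_nonneg (by positivity), abs_of_nonneg (by positivity)]
    gcongr
  rw [hlaw] at hle
  -- Equivalently `tanh (k a) ≤ c tanh (k b)` with `k = √(-κ)`.
  have key := sinh_mul_cosh_le_of_lengthen (by positivity) (mul_le_mul_of_nonneg_left hab hk.le)
    (mul_lt_mul_of_pos_left hau hk) (mul_lt_mul_of_pos_left hbv hk) hc (hle.trans hxy)
  have hsa : 0 < Real.sinh (√(-κ) * a) := Real.sinh_pos_iff.2 (by positivity)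
  have hsb : 0 < Real.sinh (√(-κ) * b) := Real.sinh_pos_iff.2 (by positivity)
  have hca := Real.one_le_cosh (√(-κ) * a)
  have hcab : Real.cosh (√(-κ) * a) ≤ Real.cosh (√(-κ) * b) := by
    rw [Real.cosh_le_cosh, abs_of_nonneg (by positivity), abs_of_nonneg (by positivity)]
    gcongr
  have hsq := Real.cosh_sq (√(-κ) * a)
  constructor
  · rw [abs_of_nonpos (by linarith)]
    refine hxy.trans ?_
    -- Hyperbolic Pythagoras as an inequality, `b` being opposite the non-acute angle.
    have h1 : (Real.cosh (√(-κ) * a) * Real.cosh (√(-κ) * b) -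
        c * (Real.sinh (√(-κ) * a) * Real.sinh (√(-κ) * b))) * Real.cosh (√(-κ) * a) ≤
        Real.cosh (√(-κ) * b) := by
      have := mul_le_mul_of_nonneg_left key hsa.le
      linear_combination this + Real.cosh (√(-κ) * b) * hsq
    have h2 : Real.cosh (√(-κ) * b) ≤ (1 + -(Real.cosh (√(-κ) * a) - Real.cosh (√(-κ) * b))) *
        Real.cosh (√(-κ) * a) := by
      nlinarith
    exact le_of_mul_le_mul_right (h1.trans h2) (by linarith)
  · intro s hs hsa' hsb'
    refine (hcomp s ⟨hs, hsa'.trans hau.le⟩ s ⟨hs, hsb'.trans hbv.le⟩).trans ?_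
    have hc' : Real.sinh (√(-κ) * a) ≤ c * Real.cosh (√(-κ) * a) := by
      refine le_of_mul_le_mul_right ?_ hsb
      nlinarith [Real.sinh_lt_cosh (√(-κ) * b)]
    have hexp := Real.cosh_sub_sinh (√(-κ) * a)
    -- Since `c ≥ tanh (k a)`, one has `1 - c ≤ exp (-k a) / cosh (k a)`.
    have h1c : 1 - c ≤ Real.exp (-(√(-κ) * a)) := by
      have h3 : 0 ≤ Real.exp (-(√(-κ) * a)) := (Real.exp_pos _).le
      nlinarith
    have h4 : 1 - c ≤ Real.exp (-(√(-κ) * a)) + Real.exp (-(√(-κ) * b)) := by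
      linarith [Real.exp_pos (-(√(-κ) * b))]
    have h5 := mul_le_mul_of_nonneg_left h4 (sq_nonneg (Real.sinh (√(-κ) * s)))
    linear_combination h5 + Real.cosh_sq (√(-κ) * s)

end

/-! ### Geodesic boundedness implies the fixed point property -/

/-- A criterion for Cauchy sequences in terms of the hyperbolic cosine of the distance. -/
theorem cauchySeq_of_cosh_dist_le {X : Type*} [MetricSpace X] {k : ℝ} (hk : 0 < k) {x : ℕ → X}
    (h : ∀ δ > 0, ∃ N : ℕ, ∀ m ≥ N, ∀ n ≥ N, Real.cosh (k * dist (x m) (x n)) < 1 + δ) :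
    CauchySeq x := by
  refine Metric.cauchySeq_iff.2 fun ε hε => ?_
  have h1 : 1 < Real.cosh (k * ε) := Real.one_lt_cosh.2 (by positivity)
  obtain ⟨N, hN⟩ := h (Real.cosh (k * ε) - 1) (by linarith)
  refine ⟨N, fun m hm n hn => ?_⟩
  have h2 := hN m hm n hn
  rw [add_sub_cancel, Real.cosh_lt_cosh, abs_of_nonneg (by positivity),
    abs_of_nonneg (by positivity)] at h2
  exact lt_of_mul_lt_mul_left h2 hk.le

open Filter Topology in
theorem HasNonexpansiveFPP.of_isGeodesicallyBounded {X : Type*} [MetricSpace X] [CompleteSpace X]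
    {κ : ℝ} (hκ : κ < 0) (hX : IsCAT κ X) {K : Set X} (hne : K.Nonempty) (hclosed : IsClosed K)
    (hconv : IsGeodesicallyConvex K) (hK : IsGeodesicallyBounded K) : HasNonexpansiveFPP K := by
  intro T hT
  by_contra! hfix
  obtain ⟨p, hp⟩ := hne
  have hk : 0 < √(-κ) := Real.sqrt_pos.2 (neg_pos.2 hκ)
  choose S hS using hX.1 p
  choose G g0 g1 hg hGS using hS
  have hG : ∀ u, G u 0 = p ∧ G u (dist p u) = u ∧ IsGeodesicOn (G u) (Set.Icc 0 (dist p u)) :=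
    fun u => ⟨g0 u, g1 u, hg u⟩
  have hGK : ∀ u ∈ K, ∀ s ∈ Set.Icc 0 (dist p u), G u s ∈ K := fun u hu s hs =>
    hconv p hp u hu _ ⟨G u, g0 u, g1 u, hg u, rfl⟩ ⟨s, hs, rfl⟩
  -- The shift by 2 gives `1 / 2 ≤ r n`, so that `A n ≤ 2 * a n` below.
  let r : ℕ → ℝ := fun n => 1 - 1 / ((n : ℝ) + 2)
  have hr : Tendsto r atTop (𝓝 1) := by
    have : Tendsto (fun n : ℕ => 1 / ((n : ℝ) + 2)) atTop (𝓝 0) :=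
      tendsto_const_nhds.div_atTop
        (tendsto_atTop_add_const_right _ _ tendsto_natCast_atTop_atTop)
    simpa [r] using this.const_sub 1
  have hr1 : ∀ n, r n < 1 := fun n => by
    have : 0 < 1 / ((n : ℝ) + 2) := by positivity
    simp only [r]; linarith
  have hr2 : ∀ n, 1 / 2 ≤ r n := fun n => by
    have : 1 / ((n : ℝ) + 2) ≤ 1 / 2 := by gcongr; linarith [n.cast_nonneg (α := ℝ)]
    simp only [r]; linarith
  have hr0 : ∀ n, 0 < r n := fun n => by linarith [hr2 n]
  choose x hx using fun n => exists_eq_contraction hκ hX hG hclosed hGK hp hT (hr0 n).le (hr1 n)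
  let A : ℕ → ℝ := fun n => dist p (T (x n))
  let a : ℕ → ℝ := fun n => r n * A n
  have hGx : ∀ n, G (T (x n)) (a n) = x n := hx
  have hA0 : ∀ n, 0 < A n := by
    intro n
    refine dist_pos.2 fun h => hfix (x n) (Subtype.ext ?_)
    have h2 := hGx n
    simp only [a, A] at h2
    rw [← h] at h2 ⊢
    rw [dist_self, mul_zero, g0] at h2
    exact h2
  have ha0 : ∀ n, 0 < a n := fun n => mul_pos (hr0 n) (hA0 n)
  have haA : ∀ n, a n < A n := fun n => mul_lt_of_lt_one_left (hA0 n) (hr1 n)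
  have hest := fun m n => hX.cosh_dist_le_of_dist_le hκ hG (ha0 m) (ha0 n) (haA m) (haA n)
    (by rw [hGx, hGx]; exact hT (x m) (x n))
  by_cases hlim : Tendsto a atTop atTop
  · have hexp : Tendsto (fun n => Real.exp (-(√(-κ) * a n))) atTop (𝓝 0) :=
      Real.tendsto_exp_neg_atTop_nhds_zero.comp (hlim.const_mul_atTop hk)
    have hcauchy : ∀ s, 0 ≤ s → CauchySeq fun n => G (T (x n)) s := by
      intro s hs
      refine cauchySeq_of_cosh_dist_le hk fun δ hδ => ?_
      have h1 : Tendsto (fun n => Real.sinh (√(-κ) * s) ^ 2 * Real.exp (-(√(-κ) * a n))) atTop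
          (𝓝 0) := by
        simpa using hexp.const_mul (Real.sinh (√(-κ) * s) ^ 2)
      obtain ⟨N, hN⟩ := eventually_atTop.1
        ((h1.eventually (gt_mem_nhds (half_pos hδ))).and (hlim.eventually_ge_atTop s))
      refine ⟨N, fun m hm n hn => ?_⟩
      have h2 := (hest m n).2 s hs (hN m hm).2 (hN n hn).2
      linarith [(hN m hm).1, (hN n hn).1]
    have hex : ∀ s : ℝ, ∃ z, 0 ≤ s → Tendsto (fun n => G (T (x n)) s) atTop (𝓝 z) := by
      intro s
      by_cases hs : 0 ≤ s
      · obtain ⟨z, hz⟩ := cauchySeq_tendsto_of_complete (hcauchy s hs)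
        exact ⟨z, fun _ => hz⟩
      · exact ⟨p, fun h => absurd h hs⟩
    choose c hc using hex
    -- `G u s` is meaningful only for `s ≤ dist p u`; for fixed `s` this holds eventually.
    have hmem : ∀ s, 0 ≤ s → ∀ᶠ n in atTop, s ∈ Set.Icc 0 (A n) := fun s hs =>
      (hlim.eventually_ge_atTop s).mono fun n hn => ⟨hs, hn.trans (haA n).le⟩
    refine hK ⟨c, fun s hs t ht => ?_, fun t ht => ?_⟩
    · refine tendsto_nhds_unique ((hc s hs).dist (hc t ht)) ?_
      refine tendsto_const_nhds.congr' ?_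
      filter_upwards [hmem s hs, hmem t ht] with n hn hn'
      exact (hg _ s hn t hn').symm
    · refine hclosed.mem_of_tendsto (hc t ht) ?_
      filter_upwards [hmem t ht] with n hn
      exact hGK _ (T (x n)).2 t hn
  · rw [tendsto_atTop] at hlim
    push Not at hlim
    obtain ⟨M, hM⟩ := hlim
    obtain ⟨φ, hφ, haM⟩ := extraction_of_frequently_atTop hM
    obtain ⟨α, -, ψ, hψ, hα⟩ := (isCompact_Icc (a := (0 : ℝ)) (b := M)).tendsto_subseq
      (x := a ∘ φ) fun n => ⟨(ha0 _).le, (haM n).le⟩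
    let y : ℕ → K := fun n => x (φ (ψ n))
    -- The first estimate in `hest` bounds distances between the `y n` by differences of these
    -- values.
    have hcosh : CauchySeq fun n => Real.cosh (√(-κ) * a (φ (ψ n))) :=
      (((Real.continuous_cosh.comp (continuous_const_mul √(-κ))).tendsto α).comp hα).cauchySeq
    have hy : CauchySeq y := by
      refine cauchySeq_of_cosh_dist_le hk fun δ hδ => ?_
      obtain ⟨N, hN⟩ := Metric.cauchySeq_iff.1 hcosh δ hδ
      refine ⟨N, fun m hm n hn => ?_⟩
      have h1 := (hest (φ (ψ m)) (φ (ψ n))).1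
      rw [hGx, hGx] at h1
      have h2 := hN m hm n hn
      rw [Real.dist_eq] at h2
      exact h1.trans_lt (by linarith)
    have : CompleteSpace K := hclosed.completeSpace_coe
    obtain ⟨z, hz⟩ := cauchySeq_tendsto_of_complete hy
    have hTc : Continuous T :=
      (LipschitzWith.of_dist_le_mul (K := 1) fun x y => by simpa using hT x y).continuous
    have hdist : Tendsto (fun n => dist (y n) (T (y n))) atTop (𝓝 0) := by
      have hb : Tendsto (fun n => (1 - r (φ (ψ n))) * (2 * M)) atTop (𝓝 0) := by
        have := ((hr.comp (hφ.comp hψ).tendsto_atTop).const_sub 1).mul_const (2 * M)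
        simpa using this
      refine squeeze_zero (fun _ => dist_nonneg) (fun n => ?_) hb
      have e : dist (y n) (T (y n)) = (1 - r (φ (ψ n))) * A (φ (ψ n)) := by
        have h1 := hg (T (y n)) _ (mul_mem_Icc_zero (hr0 (φ (ψ n))).le (hr1 _).le dist_nonneg) _
          ⟨dist_nonneg, le_rfl⟩
        rw [g1, hx (φ (ψ n))] at h1
        refine h1.trans ?_
        rw [abs_of_nonpos (by linarith [haA (φ (ψ n))])]
        simp only [A, y]
        ring
      rw [e]
      refine mul_le_mul_of_nonneg_left ?_ (by linarith [hr1 (φ (ψ n))])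
      have h2 : a (φ (ψ n)) < M := haM (ψ n)
      have h3 := mul_le_mul_of_nonneg_right (hr2 (φ (ψ n))) (hA0 (φ (ψ n))).le
      simp only [a] at h2
      linarith
    have h0 := tendsto_nhds_unique (hz.dist ((hTc.tendsto z).comp hz)) hdist
    exact hfix z (dist_eq_zero.1 h0).symm

theorem corollary4p3 {X : Type*} [MetricSpace X] [CompleteSpace X] (κ : ℝ) (hκ : κ < 0)
    (hX : IsCAT κ X) (K : Set X) (hne : K.Nonempty) (hclosed : IsClosed K)
    (hconv : IsGeodesicallyConvex K) :
    HasNonexpansiveFPP K ↔ IsGeodesicallyBounded K :=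
  ⟨IsGeodesicallyBounded.of_hasNonexpansiveFPP,
    HasNonexpansiveFPP.of_isGeodesicallyBounded hκ hX hne hclosed hconv⟩
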